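/- Let $\mathbb F$ be $\mathbb R$ or $\mathbb C$, let $d\ge 0$, let $n_k,m_k\ge 0$ for $k=1,\dots,d$, and let $\mathcal X=\bigoplus_{k=1}^d\mathbb F^{n_k m_k}$. All spaces below are finite-dimensional Euclidean spaces over $\mathbb F$, and $M>0$, $M<0$ mean that $M$ is (Hermitian and) strictly positive, respectively negative, definite. Let $$\boldsymbol\Delta=\{\operatorname{diag}(\Delta_1^0\otimes I_{n_1},\dots,\Delta_d^0\otimes I_{n_d}) : \Delta_k^0\in\mathbb C^{m_k\times m_k}\},$$ and for any such structure let $\mathcal D_{\boldsymbol\Delta}$ be the set of square matrices over $\mathbb F$ that commute with every $\Delta\in\boldsymbol\Delta$. A square matrix $A$ over $\mathbb F$ is called *$\mathcal Q$-stable* with respect to $\boldsymbol\Delta$ if there is an invertible $Q\in\mathcal D_{\boldsymbol\Delta}$ with $\|Q^{-1}AQ\|<1$ in operator norm. Let $$\begin{bmatrix}A&B_1&B_2\\ C_1&D_{11}&D_{12}\\ C_2&D_{21}&D_{22}\end{bmatrix}:\mathcal X\oplus\mathcal U_1\oplus\mathcal U_2\to\mathcal X\oplus\mathcal Y_1\oplus\mathcal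 Y_2$$ be a plant. A controller with multiplicities $n_{K1},\dots,n_{Kd}\ge 0$ is a matrix $$\begin{bmatrix}A_K&B_K\\ C_K&D_K\end{bmatrix}:\mathcal X_K\oplus\mathcal Y_2\to\mathcal X_K\oplus\mathcal U_2,\qquad \mathcal X_K=\bigoplus_{k=1}^d\mathbb F^{n_{Kk}m_k}.$$ The loop is well posed if $I-D_{22}D_K$ is invertible (automatic when $D_{22}=0$). In that case the closed-loop system matrix is $$\begin{bmatrix}A_{cl}&B_{cl}\\ C_{cl}&D_{cl}\end{bmatrix}=\mathcal F_\ell\left(\left[\begin{array}{ccc|cc}A&0&B_1&0&B_2\\0&0&0&I&0\\ C_1&0&D_{11}&0&D_{12}\\ \hline 0&I&0&0&0\\ C_2&0&D_{21}&0&D_{22}\end{array}\right],\begin{bmatrix}A_K&B_K\\ C_K&D_K\end{bmatrix}\right),$$ where $$\mathcal F_\ell\left(\begin{bmatrix}a&b\\c&e\end{bmatrix},\Delta'\right)=a+b(I-\Delta' e)^{-1}\Delta' c.$$ If $D_{22}=0$ this gives $A_{cl}=\begin{bmatrix}A+B_2D_KC_2&B_2C_K\\ B_KC_2&A_K\end{bmatrix}$.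 The controller *achieves $\mathcal Q$-stability* if the loop is well posed and $A_{cl}$, acting on $\mathcal X\oplus\mathcal X_K$, is $\mathcal Q$-stable with respect to the coupled structure $$\boldsymbol\Delta_{cl}=\{\operatorname{diag}(\Delta_1^0\otimes I_{n_1},\dots,\Delta_d^0\otimes I_{n_d},\Delta_1^0\otimes I_{n_{K1}},\dots,\Delta_d^0\otimes I_{n_{Kd}}):\Delta_k^0\in\mathbb C^{m_k\times m_k}\}.$$ **(1)** Let $B_\perp$ and $C_\perp$ be any matrices such that $B_\perp$ is injective with $\operatorname{Im}B_\perp=\operatorname{Ker}B_2^*$, and $C_\perp^*$ is injective with $\operatorname{Im}C_\perp^*=\operatorname{Ker}C_2$. There is a static output feedback controller (all $n_{Kk}=0$) that achieves $\mathcal Q$-stability if and only if there is a positive definite $X\in\mathcal D_{\boldsymbol\Delta}$ with $$B_\perp^*AX^{-1}A^*B_\perp-B_\perp^*X^{-1}B_\perp<0,\qquad C_\perp A^*XAC_\perp^*-C_\perp XC_\perp^*<0.$$ **(2)** There are multiplicities $n_{K1},\dots,n_{Kd}\ge 0$ (with no restriction) and a controller with these multiplicities that achieves $\mathcal Q$-stability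 if and only if there are positive definite $X,Y\in\mathcal D_{\boldsymbol\Delta}$ with $$AYA^*-Y-B_2B_2^*<0,\qquad A^*XA-X-C_2^*C_2<0.$$ -/

import Mathlib

open scoped Matrix Kronecker ComplexOrder

/-- Coordinates of `⊕ₖ 𝔽^(nₖ · mₖ)`: the coordinate `⟨k, (i, a)⟩` is entry `a` of the `i`-th of the
`mₖ` consecutive sub-blocks, each of size `nₖ`, of the `k`-th summand. -/
abbrev StateIdx {d : ℕ} (n m : Fin d → ℕ) : Type :=
  (k : Fin d) × (Fin (m k) × Fin (n k))

/-- The block-diagonal matrix with diagonal blocks `Δ⁰ₖ ⊗ I_{nₖ}`. -/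
def uncertaintyBlock {d : ℕ} (n m : Fin d → ℕ) (δ : (k : Fin d) → Matrix (Fin (m k)) (Fin (m k)) ℂ) :
    Matrix (StateIdx n m) (StateIdx n m) ℂ :=
  Matrix.blockDiagonal' fun k => δ k ⊗ₖ (1 : Matrix (Fin (n k)) (Fin (n k)) ℂ)

/-- The uncertainty structure `𝚫`, the entries of the `Δ⁰ₖ` being arbitrary complex numbers. -/
def uncertaintyStructure {d : ℕ} (n m : Fin d → ℕ) :
    Set (Matrix (StateIdx n m) (StateIdx n m) ℂ) :=
  Set.range (uncertaintyBlock n m)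

/-- The coupled closed-loop structure `𝚫_cl`: the same matrices `Δ⁰ₖ` appear in the plant part (with
multiplicity `nₖ`) and in the controller part (with multiplicity `n_{Kk}`). -/
def coupledStructure {d : ℕ} (n nK m : Fin d → ℕ) :
    Set (Matrix (StateIdx n m ⊕ StateIdx nK m) (StateIdx n m ⊕ StateIdx nK m) ℂ) :=
  Set.range fun δ => Matrix.fromBlocks (uncertaintyBlock n m δ) 0 0 (uncertaintyBlock nK m δ)

/-- The commutant `𝓓_𝚫`: matrices over `𝕜` (`ℝ` or `ℂ`) which, regarded as complex matrices through
the inclusion of `𝕜` in `ℂ`, commute with all elements of `𝚫`. -/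
def commutant (𝕜 : Type*) [RCLike 𝕜] {ι : Type*} [Fintype ι] (S : Set (Matrix ι ι ℂ)) :
    Set (Matrix ι ι 𝕜) :=
  {Q | ∀ Δ ∈ S, Q.map (RCLike.map 𝕜 ℂ) * Δ = Δ * Q.map (RCLike.map 𝕜 ℂ)}

/-- `𝓠`-stability of the state matrix `A` with respect to `𝚫`: some invertible `Q ∈ 𝓓_𝚫` satisfies
`‖Q⁻¹ A Q‖ < 1`, in the operator norm induced by the Euclidean norm. -/
def IsQStable {𝕜 : Type*} [RCLike 𝕜] {ι : Type*} [Fintype ι] [DecidableEq ι]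
    (A : Matrix ι ι 𝕜) (S : Set (Matrix ι ι ℂ)) : Prop :=
  ∃ Q ∈ commutant 𝕜 S, IsUnit Q ∧ ‖Matrix.toEuclideanCLM (𝕜 := 𝕜) (n := ι) (Q⁻¹ * A * Q)‖ < 1

/-- The lower linear fractional transformation
`𝓕_ℓ([A B; C D], Δ') = A + B (I - Δ' D)⁻¹ Δ' C`. -/
noncomputable def lowerLFT {𝕜 : Type*} [RCLike 𝕜] {r s a b : Type*}
    [Fintype a] [Fintype b] [DecidableEq b]
    (A : Matrix r s 𝕜) (B : Matrix r b 𝕜) (C : Matrix a s 𝕜) (D : Matrix a b 𝕜)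
    (Δ' : Matrix b a 𝕜) : Matrix r s 𝕜 :=
  A + B * (1 - Δ' * D)⁻¹ * Δ' * C

/-- The plant: a system matrix `[A B₁ B₂; C₁ D₁₁ D₁₂; C₂ D₂₁ D₂₂]` with state space
`⊕ₖ 𝕜^(nₖ · mₖ)`, disturbance, control, error and measurement spaces of dimensions
`u₁, u₂, y₁, y₂`. -/
structure LFTPlant (𝕜 : Type*) [RCLike 𝕜] {d : ℕ} (n m : Fin d → ℕ) (u₁ u₂ y₁ y₂ : ℕ) where
  A : Matrix (StateIdx n m) (StateIdx n m) 𝕜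
  B₁ : Matrix (StateIdx n m) (Fin u₁) 𝕜
  B₂ : Matrix (StateIdx n m) (Fin u₂) 𝕜
  C₁ : Matrix (Fin y₁) (StateIdx n m) 𝕜
  C₂ : Matrix (Fin y₂) (StateIdx n m) 𝕜
  D₁₁ : Matrix (Fin y₁) (Fin u₁) 𝕜
  D₁₂ : Matrix (Fin y₁) (Fin u₂) 𝕜
  D₂₁ : Matrix (Fin y₂) (Fin u₁) 𝕜
  D₂₂ : Matrix (Fin y₂) (Fin u₂) 𝕜

/-- The controller: a system matrix `[A_K B_K; C_K D_K]` with state space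
`⊕ₖ 𝕜^(n_{Kk} · mₖ)`, from measurements to controls. -/
structure LFTController (𝕜 : Type*) [RCLike 𝕜] {d : ℕ} (nK m : Fin d → ℕ) (u₂ y₂ : ℕ) where
  A : Matrix (StateIdx nK m) (StateIdx nK m) 𝕜
  B : Matrix (StateIdx nK m) (Fin y₂) 𝕜
  C : Matrix (Fin u₂) (StateIdx nK m) 𝕜
  D : Matrix (Fin u₂) (Fin y₂) 𝕜

namespace LFTPlant

variable {𝕜 : Type*} [RCLike 𝕜] {d : ℕ} {n nK m : Fin d → ℕ} {u₁ u₂ y₁ y₂ : ℕ}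

/-- Well-posedness of the feedback loop. -/
def WellPosed (P : LFTPlant 𝕜 n m u₁ u₂ y₁ y₂) (K : LFTController 𝕜 nK m u₂ y₂) : Prop :=
  IsUnit (1 - P.D₂₂ * K.D)

/-- The closed-loop system matrix `[A_cl B_cl; C_cl D_cl]`, the lower linear fractional
transformation with load `[A_K B_K; C_K D_K]` and symbol
`[A 0 B₁ | 0 B₂; 0 0 0 | I 0; C₁ 0 D₁₁ | 0 D₁₂; 0 I 0 | 0 0; C₂ 0 D₂₁ | 0 D₂₂]`. -/
noncomputable def closedLoop (P : LFTPlant 𝕜 n m u₁ u₂ y₁ y₂) (K : LFTController 𝕜 nK m u₂ y₂) :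
    Matrix ((StateIdx n m ⊕ StateIdx nK m) ⊕ Fin y₁) ((StateIdx n m ⊕ StateIdx nK m) ⊕ Fin u₁) 𝕜 :=
  lowerLFT
    (Matrix.fromBlocks (Matrix.fromBlocks P.A 0 0 0) (Matrix.fromRows P.B₁ 0)
      (Matrix.fromCols P.C₁ 0) P.D₁₁)
    (Matrix.fromRows (Matrix.fromBlocks 0 P.B₂ 1 0) (Matrix.fromCols 0 P.D₁₂))
    (Matrix.fromCols (Matrix.fromBlocks 0 1 P.C₂ 0) (Matrix.fromRows 0 P.D₂₁))
    (Matrix.fromBlocks 0 0 0 P.D₂₂)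
    (Matrix.fromBlocks K.A K.B K.C K.D)

/-- The closed-loop state matrix `A_cl`. -/
noncomputable def closedLoopA (P : LFTPlant 𝕜 n m u₁ u₂ y₁ y₂)
    (K : LFTController 𝕜 nK m u₂ y₂) :
    Matrix (StateIdx n m ⊕ StateIdx nK m) (StateIdx n m ⊕ StateIdx nK m) 𝕜 :=
  (P.closedLoop K).toBlocks₁₁

/-- The controller `K` achieves `𝓠`-stability: the loop is well posed and `A_cl` is `𝓠`-stable with
respect to the coupled structure `𝚫_cl`. -/
def IsQStabilizedBy (P : LFTPlant 𝕜 n m u₁ u₂ y₁ y₂) (K : LFTController 𝕜 nK m u₂ y₂) : Prop :=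
  P.WellPosed K ∧ IsQStable (P.closedLoopA K) (coupledStructure n nK m)

/-- When `D₂₂ = 0` the closed-loop system matrix has the usual explicit form. -/
theorem closedLoop_of_D₂₂_eq_zero (P : LFTPlant 𝕜 n m u₁ u₂ y₁ y₂)
    (K : LFTController 𝕜 nK m u₂ y₂) (h : P.D₂₂ = 0) :
    P.closedLoop K =
      Matrix.fromBlocks
        (Matrix.fromBlocks (P.A + P.B₂ * K.D * P.C₂) (P.B₂ * K.C) (K.B * P.C₂) K.A)
        (Matrix.fromRows (P.B₁ + P.B₂ * K.D * P.D₂₁) (K.B * P.D₂₁))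
        (Matrix.fromCols (P.C₁ + P.D₁₂ * K.D * P.C₂) (P.D₁₂ * K.C))
        (P.D₁₁ + P.D₁₂ * K.D * P.D₂₁) := by
  simp only [closedLoop, lowerLFT, h, Matrix.fromBlocks_zero, Matrix.mul_zero, sub_zero, inv_one,
    Matrix.mul_one]
  ext ((x | x) | x) ((y | y) | y) <;>
    simp [Matrix.mul_apply, Matrix.mul_assoc, Matrix.one_apply, Finset.mul_sum]


end LFTPlant

/-- The explicit form of the commutant: `Q = diag(Q₁, …, Q_d)` with
`Qₖ = diag(Q_{k,0}, …, Q_{k,0})`. -/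
theorem mem_commutant_uncertaintyStructure_iff {𝕜 : Type*} [RCLike 𝕜] {d : ℕ} (n m : Fin d → ℕ)
    (Q : Matrix (StateIdx n m) (StateIdx n m) 𝕜) :
    Q ∈ commutant 𝕜 (uncertaintyStructure n m) ↔
      ∃ Q₀ : (k : Fin d) → Matrix (Fin (n k)) (Fin (n k)) 𝕜,
        Q = Matrix.blockDiagonal' fun k => (1 : Matrix (Fin (m k)) (Fin (m k)) 𝕜) ⊗ₖ Q₀ k := by
  have f0 : RCLike.map 𝕜 ℂ 0 = 0 := map_zero _
  have f1 : RCLike.map 𝕜 ℂ 1 = 1 := by simp [RCLike.map_apply]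
  have finj : Function.Injective (RCLike.map 𝕜 ℂ) := by
    intro x y h
    have h1 := congrArg Complex.re h
    have h2 := congrArg Complex.im h
    simp [RCLike.map_apply] at h1 h2
    exact RCLike.ext h1 h2
  constructor
  · intro hQ
    have key : ∀ (k : Fin d) (i j : Fin (m k)) (t : Fin (n k)) (x : StateIdx n m),
        (∀ s, x = ⟨k, (i, s)⟩ → Q x ⟨k, (i, t)⟩ = Q ⟨k, (j, s)⟩ ⟨k, (j, t)⟩) ∧
        ((∀ s, x ≠ ⟨k, (i, s)⟩) → Q x ⟨k, (i, t)⟩ = 0) := by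
      intro k i j t x
      set δ : (l : Fin d) → Matrix (Fin (m l)) (Fin (m l)) ℂ := fun l => Matrix.of fun a b =>
        if (⟨l, a⟩ : (l : Fin d) × Fin (m l)) = ⟨k, i⟩ ∧
          (⟨l, b⟩ : (l : Fin d) × Fin (m l)) = ⟨k, j⟩ then 1 else 0 with hδ
      have hΔ : ∀ x y : StateIdx n m, uncertaintyBlock n m δ x y =
          if ∃ s, x = ⟨k, (i, s)⟩ ∧ y = ⟨k, (j, s)⟩ then 1 else 0 := by
        rintro ⟨l, a, s⟩ ⟨l', b, s'⟩
        by_cases hl : l = l'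
        · subst hl
          simp only [uncertaintyBlock, Matrix.blockDiagonal'_apply_eq, Matrix.kroneckerMap_apply,
            hδ, Matrix.of_apply, Matrix.one_apply]
          by_cases hk : l = k
          · subst hk
            simp only [Sigma.mk.injEq, heq_eq_eq, true_and, Prod.mk.injEq]
            split_ifs <;> simp_all
          · simp [hk]
        · rw [uncertaintyBlock, Matrix.blockDiagonal'_apply_ne _ _ _ hl, if_neg]
          rintro ⟨s, h1, h2⟩
          exact hl ((congrArg Sigma.fst h1).trans (congrArg Sigma.fst h2).symm)
      have h := congrFun (congrFun (hQ _ ⟨δ, rfl⟩) x) ⟨k, (j, t)⟩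
      simp only [Matrix.mul_apply, hΔ, Matrix.map_apply] at h
      rw [Finset.sum_eq_single (⟨k, (i, t)⟩ : StateIdx n m)] at h
      rotate_left
      · rintro y - hy
        rw [if_neg, mul_zero]
        rintro ⟨s, h1, h2⟩
        apply hy
        simp only [Sigma.mk.injEq, heq_eq_eq, true_and, Prod.mk.injEq] at h2
        rw [h1, h2]
      · simp
      rw [if_pos ⟨t, rfl, rfl⟩, mul_one] at h
      constructor
      · rintro s rfl
        rw [Finset.sum_eq_single (⟨k, (j, s)⟩ : StateIdx n m)] at h
        · rw [if_pos ⟨s, rfl, rfl⟩, one_mul] at h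
          exact finj h
        · rintro y - hy
          rw [if_neg, zero_mul]
          rintro ⟨s', h1, h2⟩
          apply hy
          simp only [Sigma.mk.injEq, heq_eq_eq, true_and, Prod.mk.injEq] at h1
          rw [h2, h1]
        · simp
      · intro hx
        rw [Finset.sum_eq_zero] at h
        · exact finj (h.trans f0.symm)
        · rintro y -
          rw [if_neg, zero_mul]
          rintro ⟨s', h1, -⟩
          exact hx s' h1
    refine ⟨fun k => Matrix.of fun s t =>
      if h : 0 < m k then Q ⟨k, (⟨0, h⟩, s)⟩ ⟨k, (⟨0, h⟩, t)⟩ else 0, ?_⟩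
    ext ⟨l, a, s⟩ ⟨k, i, t⟩
    by_cases hl : l = k
    · subst hl
      have hpos : 0 < m l := i.pos
      by_cases ha : a = i
      · subst ha
        rw [(key l a ⟨0, hpos⟩ t _).1 s rfl]
        simp [Matrix.blockDiagonal'_apply_eq, hpos]
      · rw [(key l i i t _).2 (by simp [ha])]
        simp [Matrix.blockDiagonal'_apply_eq, ha]
    · rw [(key k i i t _).2 (by simp [hl]), Matrix.blockDiagonal'_apply_ne _ _ _ hl]
  · rintro ⟨Q₀, rfl⟩ _ ⟨δ, rfl⟩
    have hmap : ((Matrix.blockDiagonal' fun k =>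
        (1 : Matrix (Fin (m k)) (Fin (m k)) 𝕜) ⊗ₖ Q₀ k).map (RCLike.map 𝕜 ℂ)) =
        Matrix.blockDiagonal' fun k =>
          (1 : Matrix (Fin (m k)) (Fin (m k)) ℂ) ⊗ₖ (Q₀ k).map (RCLike.map 𝕜 ℂ) := by
      rw [Matrix.blockDiagonal'_map _ _ f0]
      congr 1
      funext k
      ext ⟨a, s⟩ ⟨b, t⟩
      by_cases hab : a = b
      · simp [hab]
      · simp [hab]
    rw [hmap, uncertaintyBlock, ← Matrix.blockDiagonal'_mul, ← Matrix.blockDiagonal'_mul]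
    congr 1
    funext k
    rw [← Matrix.mul_kronecker_mul, ← Matrix.mul_kronecker_mul]
    simp

/-!
Joining the controller state to the plant state makes the controller a static gain `K`, and the
feedthrough `D₂₂` can be removed from the loop, since the gains `K` that make the loop well posed
are dense and `𝓠`-stability is an open condition. So one asks for a `K` with `A + B K C` `𝓠`-stable.

By square roots in the commutant, `𝓠`-stability is the Stein inequality `W - A W Aᴴ > 0` for some
positive definite `W` commuting with the uncertainty structure. For fixed `W`, two applications of
Finsler's lemma and of completing the square eliminate `K` and leave one inequality on `ker Bᴴ` and
one on `ker C`. For the augmented plant these see only the upper left blocks `X` of `W⁻¹` and `Y` of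
`W`. Without controller states `Y = X⁻¹`. With `n` controller states any `X`, `Y` with `X > Y⁻¹`
occur, by Schur complements, and as the inequalities are homogeneous, `X` can be scaled up.
-/

section QuadraticForm

open Matrix

variable {𝕜 : Type*} [RCLike 𝕜] {ι κ : Type*} [Fintype ι] [Fintype κ]

/-- Positive definiteness on a subspace: the quadratic form of `M` is positive at the nonzero
vectors of `V`. Only the real part of the form is tested, so for non-Hermitian `M` this is a
condition on the Hermitian part of `M`. -/
def PosDefOn (M : Matrix ι ι 𝕜) (V : Submodule 𝕜 (ι → 𝕜)) : Prop :=
  ∀ x ∈ V, x ≠ 0 → 0 < RCLike.re (star x ⬝ᵥ M *ᵥ x)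

theorem posDefOn_of_posDef {M : Matrix ι ι 𝕜} (hM : M.PosDef) (V : Submodule 𝕜 (ι → 𝕜)) :
    PosDefOn M V :=
  fun _ _ hx => hM.re_dotProduct_pos hx

theorem posDef_iff_posDefOn_top {M : Matrix ι ι 𝕜} (hM : M.IsHermitian) :
    M.PosDef ↔ PosDefOn M ⊤ := by
  refine ⟨fun h => posDefOn_of_posDef h ⊤, fun h => ?_⟩
  refine PosDef.of_dotProduct_mulVec_pos hM fun x hx => ?_
  exact RCLike.pos_iff.2 ⟨h x trivial hx, hM.im_star_dotProduct_mulVec_self x⟩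

theorem star_dotProduct_mul_conjTranspose_mulVec (B : Matrix ι κ 𝕜) (M : Matrix κ κ 𝕜)
    (x : ι → 𝕜) :
    star x ⬝ᵥ (B * M * Bᴴ) *ᵥ x = star (Bᴴ *ᵥ x) ⬝ᵥ M *ᵥ (Bᴴ *ᵥ x) := by
  rw [star_mulVec, conjTranspose_conjTranspose, ← dotProduct_mulVec, mulVec_mulVec, mulVec_mulVec,
    Matrix.mul_assoc]

theorem posDef_conjTranspose_mul_mul_iff_posDefOn_range {M : Matrix ι ι 𝕜} (hM : M.IsHermitian)
    {B : Matrix ι κ 𝕜} (hB : Function.Injective B.mulVecLin) :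
    (Bᴴ * M * B).PosDef ↔ PosDefOn M (LinearMap.range B.mulVecLin) := by
  have hform (z : κ → 𝕜) : star z ⬝ᵥ (Bᴴ * M * B) *ᵥ z = star (B *ᵥ z) ⬝ᵥ M *ᵥ (B *ᵥ z) := by
    simpa using star_dotProduct_mul_conjTranspose_mulVec Bᴴ M z
  rw [posDef_iff_posDefOn_top (isHermitian_conjTranspose_mul_mul B hM)]
  constructor
  · rintro h _ ⟨z, rfl⟩ hz
    have := h z trivial (by rintro rfl; simp at hz)
    rwa [hform] at this
  · intro h z _ hz
    rw [hform]
    exact h _ ⟨z, rfl⟩ ((map_ne_zero_iff _ hB).2 hz)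

theorem exists_forall_mem_add_mul_pos {E : Type*} [TopologicalSpace E] {K : Set E}
    (hK : IsCompact K) {f g : E → ℝ} (hf : Continuous f) (hg : Continuous g) (hg0 : ∀ x, 0 ≤ g x)
    (h : ∀ x ∈ K, g x = 0 → 0 < f x) : ∃ t : ℝ, 0 < t ∧ ∀ x ∈ K, 0 < f x + t * g x := by
  let U (k : ℕ) : Set E := {x | 0 < f x + (k + 1) * g x}
  have hU_open (k : ℕ) : IsOpen (U k) := isOpen_lt continuous_const (by fun_prop)
  have hU_mono : Monotone U := by
    intro i j hij x (hx : 0 < f x + (i + 1) * g x)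
    have := hg0 x
    exact hx.trans_le (by gcongr)
  have hU_cover : K ⊆ ⋃ k, U k := by
    intro x hx
    rcases (hg0 x).eq_or_lt with hgx | hgx
    · exact Set.mem_iUnion.2 ⟨0, by simpa [U, ← hgx] using h x hx hgx.symm⟩
    · obtain ⟨k, hk⟩ := exists_nat_gt (-f x / g x)
      rw [div_lt_iff₀ hgx] at hk
      exact Set.mem_iUnion.2 ⟨k, show 0 < f x + (k + 1) * g x by linarith⟩
  obtain ⟨k, hk⟩ := hK.elim_directed_cover U hU_open hU_cover hU_mono.directed_le
  exact ⟨k + 1, by positivity, fun x hx => hk hx⟩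

theorem posDefOn_of_forall_mem_sphere {M : Matrix ι ι 𝕜} {V : Submodule 𝕜 (ι → 𝕜)}
    (h : ∀ x ∈ V, x ∈ Metric.sphere 0 1 → 0 < RCLike.re (star x ⬝ᵥ M *ᵥ x)) : PosDefOn M V := by
  intro x hxV hx
  have hx' : 0 < ‖x‖⁻¹ := inv_pos.2 (norm_pos_iff.2 hx)
  have := h (((‖x‖⁻¹ : ℝ) : 𝕜) • x) (V.smul_mem _ hxV) (by simp [norm_smul, norm_ne_zero_iff.2 hx])
  simp only [mulVec_smul, star_smul, smul_dotProduct, dotProduct_smul, smul_eq_mul,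
    RCLike.star_def, RCLike.conj_ofReal, RCLike.re_ofReal_mul] at this
  exact (mul_pos_iff_of_pos_left hx').1 ((mul_pos_iff_of_pos_left hx').1 this)

theorem exists_posDef_add_smul {M G : Matrix ι ι 𝕜} (hM : M.IsHermitian) (hG : G.PosSemidef)
    (h : PosDefOn M (LinearMap.ker G.mulVecLin)) : ∃ t : ℝ, 0 < t ∧ (M + t • G).PosDef := by
  obtain ⟨t, ht, htM⟩ := exists_forall_mem_add_mul_pos (isCompact_sphere (0 : ι → 𝕜) 1)
    (f := fun x => RCLike.re (star x ⬝ᵥ M *ᵥ x)) (g := fun x => RCLike.re (star x ⬝ᵥ G *ᵥ x))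
    (by fun_prop) (by fun_prop) hG.re_dotProduct_nonneg fun x hx hGx =>
      h x ((hG.dotProduct_mulVec_zero_iff x).1
        (RCLike.ext (by simpa using hGx) (by simpa using hG.1.im_star_dotProduct_mulVec_self x)))
        (ne_zero_of_mem_unit_sphere ⟨x, hx⟩)
  have hsum : (M + t • G).IsHermitian := hM.add (hG.smul ht.le).1
  refine ⟨t, ht, (posDef_iff_posDefOn_top hsum).2 (posDefOn_of_forall_mem_sphere fun x _ hx => ?_)⟩
  rw [add_mulVec, smul_mulVec, dotProduct_add, dotProduct_smul, map_add, RCLike.smul_re]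
  exact htM x hx

/-- Finsler's lemma. -/
theorem posDefOn_ker_iff_exists_posDef_add {M : Matrix ι ι 𝕜} (hM : M.IsHermitian)
    (B : Matrix ι κ 𝕜) :
    PosDefOn M (LinearMap.ker Bᴴ.mulVecLin) ↔
      ∃ t : ℝ, 0 < t ∧ (M + (t • B) * (t • B)ᴴ).PosDef := by
  constructor
  · intro h
    obtain ⟨t, ht, htM⟩ := exists_posDef_add_smul hM (posSemidef_self_mul_conjTranspose B)
      fun x hx => h x ((self_mul_conjTranspose_mulVec_eq_zero B x).1 hx)
    refine ⟨√t, Real.sqrt_pos.2 ht, ?_⟩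
    rwa [conjTranspose_smul, star_trivial, smul_mul, Matrix.mul_smul, smul_smul,
      Real.mul_self_sqrt ht.le]
  · rintro ⟨t, -, h⟩ x hBx hx
    have hBx' : (t • B)ᴴ *ᵥ x = 0 := by
      rw [conjTranspose_smul, smul_mulVec, show Bᴴ *ᵥ x = 0 from hBx, smul_zero]
    have := h.re_dotProduct_pos hx
    rwa [add_mulVec, ← mulVec_mulVec, hBx', mulVec_zero, add_zero] at this

end QuadraticForm

section Stein

open Matrix

variable {𝕜 : Type*} [RCLike 𝕜] {ι κ μ : Type*} [Fintype ι] [Fintype κ] [Fintype μ]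

/-- The Stein (discrete-time Lyapunov) operator `W ↦ W - A W Aᴴ` of a state matrix `A`. -/
def stein (A W : Matrix ι ι 𝕜) : Matrix ι ι 𝕜 :=
  W - A * W * Aᴴ

theorem isHermitian_stein {W : Matrix ι ι 𝕜} (hW : W.IsHermitian) (A : Matrix ι ι 𝕜) :
    (stein A W).IsHermitian :=
  hW.sub (isHermitian_mul_mul_conjTranspose A hW)

theorem stein_smul (t : ℝ) (A W : Matrix ι ι 𝕜) : stein A (t • W) = t • stein A W := by
  simp [stein, smul_sub]

theorem star_dotProduct_stein_mulVec (A W : Matrix ι ι 𝕜) (x : ι → 𝕜) :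
    star x ⬝ᵥ stein A W *ᵥ x = star x ⬝ᵥ W *ᵥ x - star (Aᴴ *ᵥ x) ⬝ᵥ W *ᵥ (Aᴴ *ᵥ x) := by
  rw [stein, sub_mulVec, dotProduct_sub, star_dotProduct_mul_conjTranspose_mulVec]

theorem PosDefOn.stein_smul {A W : Matrix ι ι 𝕜} {V : Submodule 𝕜 (ι → 𝕜)}
    (h : PosDefOn (stein A W) V) {t : ℝ} (ht : 0 < t) : PosDefOn (stein A (t • W)) V := by
  intro x hxV hx
  rw [_root_.stein_smul, smul_mulVec, dotProduct_smul, RCLike.smul_re]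
  exact mul_pos ht (h x hxV hx)

theorem posDefOn_stein_add_mul_iff (A W : Matrix ι ι 𝕜) (B : Matrix ι κ 𝕜) (L : Matrix κ ι 𝕜) :
    PosDefOn (stein (A + B * L) W) (LinearMap.ker Bᴴ.mulVecLin) ↔
      PosDefOn (stein A W) (LinearMap.ker Bᴴ.mulVecLin) := by
  refine forall₂_congr fun x (hx : Bᴴ *ᵥ x = 0) => ?_
  have : (A + B * L)ᴴ *ᵥ x = Aᴴ *ᵥ x := by
    rw [conjTranspose_add, conjTranspose_mul, add_mulVec, ← mulVec_mulVec, hx, mulVec_zero,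
      add_zero]
  rw [star_dotProduct_stein_mulVec, star_dotProduct_stein_mulVec, this]

variable [DecidableEq ι]

theorem inv_mul_cancel_of_posDef {W : Matrix ι ι 𝕜} (hW : W.PosDef) : W⁻¹ * W = 1 :=
  nonsing_inv_mul _ ((isUnit_iff_isUnit_det _).1 hW.isUnit)

theorem mul_inv_cancel_of_posDef {W : Matrix ι ι 𝕜} (hW : W.PosDef) : W * W⁻¹ = 1 :=
  mul_nonsing_inv _ ((isUnit_iff_isUnit_det _).1 hW.isUnit)

theorem posDef_inv_sub_conjTranspose_mul_inv_mul [DecidableEq κ] {V : Matrix ι ι 𝕜}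
    (hV : V.PosDef) {W : Matrix κ κ 𝕜} {A : Matrix κ ι 𝕜} (h : (W - A * V * Aᴴ).PosDef) :
    (V⁻¹ - Aᴴ * W⁻¹ * A).PosDef := by
  set M := W - A * V * Aᴴ with hM
  have hP : (V + V * Aᴴ * M⁻¹ * (A * V)).PosDef := by
    refine hV.add_posSemidef ?_
    simpa [conjTranspose_mul, hV.1.eq] using h.inv.posSemidef.conjTranspose_mul_mul_same (A * V)
  have hW : W.PosDef := by
    simpa [hM] using h.add_posSemidef (hV.posSemidef.mul_mul_conjTranspose_same A)
  have hVV := inv_mul_cancel_of_posDef hV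
  have hMW : M⁻¹⁻¹ + A * V * V⁻¹ * (V * Aᴴ) = W := by
    rw [nonsing_inv_nonsing_inv _ ((isUnit_iff_isUnit_det _).1 h.isUnit),
      Matrix.mul_assoc _ V⁻¹, ← Matrix.mul_assoc V⁻¹, hVV, Matrix.one_mul, hM, sub_add_cancel]
  have hP_inv : (V + V * Aᴴ * M⁻¹ * (A * V))⁻¹ = V⁻¹ - Aᴴ * W⁻¹ * A := by
    rw [add_mul_mul_inv_eq_sub V _ _ _ hV.isUnit h.inv.isUnit (hMW ▸ hW.isUnit), hMW]
    simp only [← Matrix.mul_assoc, hVV, Matrix.one_mul]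
    simp only [Matrix.mul_assoc, mul_inv_cancel_of_posDef hV, Matrix.mul_one]
  exact hP_inv ▸ hP.inv

/-- The minimum over `U` of `(A + B U)ᴴ Y⁻¹ (A + B U) + Uᴴ U` is `Aᴴ (Y + B Bᴴ)⁻¹ A`. -/
theorem complete_square {ν : Type*} [DecidableEq κ] {Y : Matrix ι ι 𝕜} (hY : Y.PosDef)
    (A : Matrix ι ν 𝕜) (B : Matrix ι κ 𝕜) (U : Matrix κ ν 𝕜) :
    (A + B * U)ᴴ * Y⁻¹ * (A + B * U) + Uᴴ * U =
      Aᴴ * (Y + B * Bᴴ)⁻¹ * A +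
        (U + Bᴴ * (Y + B * Bᴴ)⁻¹ * A)ᴴ * (1 + Bᴴ * Y⁻¹ * B) * (U + Bᴴ * (Y + B * Bᴴ)⁻¹ * A) := by
  have hZ : (Y + B * Bᴴ).PosDef := hY.add_posSemidef (posSemidef_self_mul_conjTranspose B)
  set Z := Y + B * Bᴴ with hZY
  set R := 1 + Bᴴ * Y⁻¹ * B with hR
  set F := Bᴴ * Z⁻¹ * A with hF
  have hBB : B * Bᴴ = Z - Y := by simp [hZY]
  have hYYZ : Y⁻¹ * (Z - Y) * Z⁻¹ = Y⁻¹ - Z⁻¹ := by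
    rw [Matrix.mul_sub, inv_mul_cancel_of_posDef hY, Matrix.sub_mul, Matrix.mul_assoc,
      mul_inv_cancel_of_posDef hZ, Matrix.mul_one, Matrix.one_mul]
  have hRF : R * F = Bᴴ * Y⁻¹ * A := calc
    _ = Bᴴ * (Z⁻¹ + Y⁻¹ * (B * Bᴴ) * Z⁻¹) * A := by
      simp only [hR, hF, Matrix.add_mul, Matrix.mul_add, Matrix.one_mul, Matrix.mul_assoc]
    _ = Bᴴ * Y⁻¹ * A := by rw [hBB, hYYZ, add_sub_cancel]
  have hFR : Fᴴ * R = Aᴴ * Y⁻¹ * B := by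
    simpa [hR, conjTranspose_mul, Matrix.mul_assoc, hY.1.inv.eq] using congrArg conjTranspose hRF
  have hFRF : Fᴴ * R * F = Aᴴ * Y⁻¹ * A - Aᴴ * Z⁻¹ * A := calc
    _ = Aᴴ * (Y⁻¹ * (B * Bᴴ) * Z⁻¹) * A := by rw [hFR]; simp only [hF, Matrix.mul_assoc]
    _ = _ := by rw [hBB, hYYZ, Matrix.mul_sub, Matrix.sub_mul]
  have hUF : (U + F)ᴴ * R * (U + F) = Uᴴ * R * U + Uᴴ * (R * F) + Fᴴ * R * U + Fᴴ * R * F := by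
    simp only [conjTranspose_add, Matrix.add_mul, Matrix.mul_add, Matrix.mul_assoc]
    abel
  rw [hUF, hRF, hFRF, hFR, hR]
  simp only [conjTranspose_add, conjTranspose_mul, Matrix.add_mul, Matrix.mul_add, Matrix.mul_one,
    Matrix.mul_assoc]
  abel

theorem posDef_sub_of_posDef_add_sub {H T G : Matrix ι ι 𝕜} (hH : H.PosDef) (hT : T.PosSemidef)
    (h : (H + T - G).PosDef) :
    (H - ((H + T)⁻¹ * H)ᴴ * G * ((H + T)⁻¹ * H)).PosDef := by
  have hN : (H + T).PosDef := hH.add_posSemidef hT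
  set N := H + T with hNHT
  set J := N⁻¹ * H
  have hJ : IsUnit J := hN.inv.isUnit.mul hH.isUnit
  have hNJ : N * J = H := by
    rw [← Matrix.mul_assoc, mul_inv_cancel_of_posDef hN, Matrix.one_mul]
  have hJN : Jᴴ * N = H := by
    simpa [conjTranspose_mul, hH.1.eq, hN.1.eq] using congrArg conjTranspose hNJ
  have hsplit : H - Jᴴ * G * J = Jᴴ * (N - G) * J + ((1 - J)ᴴ * H * (1 - J) + Jᴴ * T * J) := by
    have hT' : Jᴴ * T * J = H * J - Jᴴ * H * J := calc
      _ = Jᴴ * (N - H) * J := by rw [hNHT, add_sub_cancel_left]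
      _ = _ := by rw [Matrix.mul_sub, Matrix.sub_mul, hJN]
    have hNJ' : Jᴴ * N * J = Jᴴ * H := by rw [Matrix.mul_assoc, hNJ]
    rw [Matrix.mul_sub, Matrix.sub_mul, hNJ', hT', conjTranspose_sub, conjTranspose_one]
    noncomm_ring
  rw [hsplit]
  refine PosDef.add_posSemidef ?_ (.add ?_ ?_)
  · exact (IsUnit.posDef_star_left_conjugate_iff hJ).2 h
  · exact hH.posSemidef.conjTranspose_mul_mul_same _
  · exact hT.conjTranspose_mul_mul_same _

/-- The gain `K` is the regularised least-squares solution of `K C ≈ -F`, with weight `H⁻¹`, where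
`-F` is the optimal state feedback. -/
theorem exists_outputFeedback_posDef {Y : Matrix ι ι 𝕜} (hY : Y.PosDef) (A : Matrix ι ι 𝕜)
    (B : Matrix ι κ 𝕜) (C : Matrix μ ι 𝕜) (hB : (stein A Y + B * Bᴴ).PosDef)
    (hC : (stein Aᴴ Y⁻¹ + Cᴴ * C).PosDef) :
    ∃ K : Matrix κ μ 𝕜, (stein (A + B * K * C)ᴴ Y⁻¹).PosDef := by
  classical
  set H := Y⁻¹ - Aᴴ * (Y + B * Bᴴ)⁻¹ * A
  have hH : H.PosDef := by
    refine posDef_inv_sub_conjTranspose_mul_inv_mul hY ?_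
    rwa [add_sub_right_comm]
  have hT : (Cᴴ * C).PosSemidef := posSemidef_conjTranspose_mul_self C
  have hN : (H + Cᴴ * C).PosDef := hH.add_posSemidef hT
  set R := 1 + Bᴴ * Y⁻¹ * B
  set F := Bᴴ * (Y + B * Bᴴ)⁻¹ * A
  have hsquare (U : Matrix κ ι 𝕜) :
      stein (A + B * U)ᴴ Y⁻¹ = H - (U + F)ᴴ * R * (U + F) + Uᴴ * U := by
    rw [stein, conjTranspose_conjTranspose, eq_sub_of_add_eq (complete_square hY A B U)]
    simp only [H, R, F]
    abel
  set J := (H + Cᴴ * C)⁻¹ * H with hJ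
  refine ⟨-(F * (H + Cᴴ * C)⁻¹ * Cᴴ), ?_⟩
  set U := -(F * (H + Cᴴ * C)⁻¹ * Cᴴ) * C with hU
  have hUF : U + F = F * J := by
    have : (H + Cᴴ * C)⁻¹ * (Cᴴ * C) = 1 - J := by
      rw [eq_sub_iff_add_eq', hJ, ← Matrix.mul_add, inv_mul_cancel_of_posDef hN]
    rw [hU, Matrix.neg_mul, Matrix.mul_assoc, Matrix.mul_assoc, this, Matrix.mul_sub,
      Matrix.mul_one]
    abel
  have hclosed : stein (A + B * -(F * (H + Cᴴ * C)⁻¹ * Cᴴ) * C)ᴴ Y⁻¹ =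
      H - Jᴴ * (Fᴴ * R * F) * J + Uᴴ * U := by
    rw [Matrix.mul_assoc B, ← hU, hsquare, hUF, conjTranspose_mul]
    simp only [Matrix.mul_assoc]
  have hgap : H + Cᴴ * C - Fᴴ * R * F = stein Aᴴ Y⁻¹ + Cᴴ * C := by
    simpa [add_sub_right_comm] using congrArg (· + Cᴴ * C) (hsquare 0).symm
  rw [hclosed]
  exact (posDef_sub_of_posDef_add_sub hH hT (hgap ▸ hC)).add_posSemidef
    (posSemidef_conjTranspose_mul_self U)

end Stein

section OperatorNorm

open Matrix

variable {𝕜 : Type*} [RCLike 𝕜]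

theorem opNorm_lt_one_iff {E F : Type*} [NormedAddCommGroup E] [NormedSpace 𝕜 E] [ProperSpace E]
    [SeminormedAddCommGroup F] [NormedSpace 𝕜 F] (L : E →L[𝕜] F) :
    ‖L‖ < 1 ↔ ∀ x ≠ 0, ‖L x‖ < ‖x‖ := by
  constructor
  · intro hL x hx
    calc ‖L x‖ ≤ ‖L‖ * ‖x‖ := L.le_opNorm x
      _ < ‖x‖ := mul_lt_of_lt_one_left (norm_pos_iff.2 hx) hL
  · intro h
    rw [← L.sSup_unitClosedBall_eq_norm, (isCompact_closedBall 0 1).sSup_lt_iff_of_continuous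
      (Metric.nonempty_closedBall.2 zero_le_one) (by fun_prop)]
    intro x hx
    rcases eq_or_ne x 0 with rfl | hx0
    · simp
    · exact (h x hx0).trans_le (mem_closedBall_zero_iff.1 hx)

variable {ι : Type*} [Fintype ι] [DecidableEq ι]

theorem norm_toEuclideanCLM_lt_one_iff_posDef_one_sub_mul_conjTranspose (T : Matrix ι ι 𝕜) :
    ‖toEuclideanCLM (𝕜 := 𝕜) (n := ι) T‖ < 1 ↔ (1 - T * Tᴴ).PosDef := by
  have hnorm (x : ι → 𝕜) : RCLike.re (star x ⬝ᵥ x) = ‖WithLp.toLp 2 x‖ ^ 2 := by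
    rw [← inner_self_eq_norm_sq (𝕜 := 𝕜), EuclideanSpace.inner_toLp_toLp, dotProduct_comm]
  have hform (x : ι → 𝕜) : RCLike.re (star x ⬝ᵥ (1 - T * Tᴴ) *ᵥ x) =
      ‖WithLp.toLp 2 x‖ ^ 2 - ‖WithLp.toLp 2 (Tᴴ *ᵥ x)‖ ^ 2 := by
    have := star_dotProduct_stein_mulVec T 1 x
    rw [stein, Matrix.mul_one, one_mulVec, one_mulVec] at this
    rw [this, map_sub, hnorm, hnorm]
  have hadj : ‖toEuclideanCLM (𝕜 := 𝕜) (n := ι) T‖ = ‖toEuclideanCLM (𝕜 := 𝕜) (n := ι) Tᴴ‖ := by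
    rw [← star_eq_conjTranspose, map_star, ContinuousLinearMap.star_eq_adjoint,
      LinearIsometryEquiv.norm_map]
  rw [hadj, opNorm_lt_one_iff, posDef_iff_posDefOn_top
    (isHermitian_one.sub (isHermitian_mul_conjTranspose_self T))]
  constructor
  · intro h x _ hx
    have := h (WithLp.toLp 2 x) (by simpa using hx)
    rw [toEuclideanCLM_toLp] at this
    rw [hform]
    exact sub_pos.2 (by gcongr)
  · intro h x hx
    have := h x.ofLp trivial (by simpa using hx)
    rw [hform, sub_pos] at this
    exact lt_of_pow_lt_pow_left₀ 2 (norm_nonneg _) this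

end OperatorNorm

section Commutant

open Matrix

variable {𝕜 : Type*} [RCLike 𝕜] {ι : Type*} [Fintype ι] {S : Set (Matrix ι ι ℂ)}

theorem smul_mem_commutant {Q : Matrix ι ι 𝕜} (t : ℝ) (hQ : Q ∈ commutant 𝕜 S) :
    t • Q ∈ commutant 𝕜 S := by
  intro Δ hΔ
  change (RCLike.map 𝕜 ℂ).mapMatrix (t • Q) * Δ = Δ * (RCLike.map 𝕜 ℂ).mapMatrix (t • Q)
  rw [map_smul, Matrix.smul_mul, Matrix.mul_smul]
  exact congrArg (t • ·) (hQ Δ hΔ)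

theorem sub_mem_commutant {Q R : Matrix ι ι 𝕜} (hQ : Q ∈ commutant 𝕜 S) (hR : R ∈ commutant 𝕜 S) :
    Q - R ∈ commutant 𝕜 S := by
  intro Δ hΔ
  change (RCLike.map 𝕜 ℂ).mapMatrix (Q - R) * Δ = Δ * (RCLike.map 𝕜 ℂ).mapMatrix (Q - R)
  rw [map_sub, Matrix.sub_mul, Matrix.mul_sub]
  exact congrArg₂ (· - ·) (hQ Δ hΔ) (hR Δ hΔ)

theorem map_mul_to_complex (x y : 𝕜) :
    RCLike.map 𝕜 ℂ (x * y) = RCLike.map 𝕜 ℂ x * RCLike.map 𝕜 ℂ y := by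
  apply Complex.ext <;> simp [RCLike.map_apply]

variable [DecidableEq ι]

variable (𝕜 ι) in
/-- The entrywise inclusion of matrices over `𝕜` in complex matrices, as a homomorphism of real
⋆-algebras. -/
noncomputable def complexify : Matrix ι ι 𝕜 →⋆ₐ[ℝ] Matrix ι ι ℂ where
  toFun Q := Q.map (RCLike.map 𝕜 ℂ)
  map_one' := Matrix.map_one _ (map_zero _) (by simp [RCLike.map_apply])
  map_mul' P Q := by
    ext i j
    simp only [Matrix.map_apply, Matrix.mul_apply, map_sum, map_mul_to_complex]
  map_zero' := Matrix.map_zero _ (map_zero _)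
  map_add' := Matrix.map_add _ (map_add _)
  commutes' r := by
    ext i j
    by_cases h : i = j <;> simp [Matrix.algebraMap_matrix_apply, h, RCLike.map_apply]
  map_star' Q := by
    ext i j
    simp [star_apply]

variable (𝕜) in
/-- The commutant of `S`, or rather of the ⋆-closure of `S`, as a real ⋆-algebra. -/
noncomputable def commutantStarSubalgebra (S : Set (Matrix ι ι ℂ)) :
    StarSubalgebra ℝ (Matrix ι ι 𝕜) :=
  (StarSubalgebra.centralizer ℝ S).comap (complexify 𝕜 ι)

theorem mem_commutantStarSubalgebra (hS : star S = S) {Q : Matrix ι ι 𝕜} :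
    Q ∈ commutantStarSubalgebra 𝕜 S ↔ Q ∈ commutant 𝕜 S := by
  change complexify 𝕜 ι Q ∈ (S ∪ star S).centralizer ↔ _
  rw [hS, Set.union_self]
  exact forall₂_congr fun _ _ => eq_comm

theorem isClosed_commutantStarSubalgebra (S : Set (Matrix ι ι ℂ)) :
    IsClosed (commutantStarSubalgebra 𝕜 S : Set (Matrix ι ι 𝕜)) :=
  (commutantStarSubalgebra 𝕜 S).toSubalgebra.toSubmodule.closed_of_finiteDimensional

theorem inv_mem_commutant {Q : Matrix ι ι 𝕜} (hQ : Q ∈ commutant 𝕜 S) (hQu : IsUnit Q) :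
    Q⁻¹ ∈ commutant 𝕜 S := by
  intro Δ hΔ
  lift Q to (Matrix ι ι 𝕜)ˣ using hQu
  rw [← Matrix.coe_units_inv]
  exact Commute.units_inv_left
    (u := Units.map (complexify 𝕜 ι : Matrix ι ι 𝕜 →* Matrix ι ι ℂ) Q) (hQ Δ hΔ)

open scoped MatrixOrder in
theorem exists_mul_conjTranspose_eq_of_mem_commutant (hS : star S = S) {W : Matrix ι ι 𝕜}
    (hW : W ∈ commutant 𝕜 S) (hWpos : W.PosDef) :
    ∃ Q ∈ commutant 𝕜 S, IsUnit Q ∧ Q * Qᴴ = W := by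
  have := isClosed_commutantStarSubalgebra (𝕜 := 𝕜) S
  have hsqrt : (CFC.sqrt W).PosSemidef := (CFC.sqrt_nonneg W).posSemidef
  refine ⟨CFC.sqrt W, ?_, ?_, ?_⟩
  · rw [← mem_commutantStarSubalgebra hS] at hW ⊢
    rw [CFC.sqrt_eq_cfc, cfc_nnreal_eq_real _ W]
    exact cfc_mem _ hW
  · exact (CFC.isUnit_sqrt_iff W hWpos.posSemidef.nonneg).2 hWpos.isUnit
  · rw [hsqrt.1.eq, CFC.sqrt_mul_sqrt_self W hWpos.posSemidef.nonneg]

end Commutant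

section UncertaintyStructure

open Matrix

variable {𝕜 : Type*} [RCLike 𝕜] {d : ℕ} {n nK m : Fin d → ℕ}

theorem uncertaintyBlock_conjTranspose (δ : (k : Fin d) → Matrix (Fin (m k)) (Fin (m k)) ℂ) :
    (uncertaintyBlock n m δ)ᴴ = uncertaintyBlock n m fun k => (δ k)ᴴ := by
  simp only [uncertaintyBlock, blockDiagonal'_conjTranspose, conjTranspose_kronecker,
    conjTranspose_one]

theorem star_range_of_star_comp {α β : Type*} [InvolutiveStar α] [InvolutiveStar β] {f : α → β}
    (hf : ∀ a, star (f a) = f (star a)) : star (Set.range f) = Set.range f := by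
  ext b
  constructor
  · rintro ⟨a, ha⟩
    exact ⟨star a, by rw [← hf, ha, star_star]⟩
  · rintro ⟨a, rfl⟩
    exact ⟨star a, (hf a).symm⟩

theorem star_coupledStructure : star (coupledStructure n nK m) = coupledStructure n nK m :=
  star_range_of_star_comp fun δ => by
    rw [star_eq_conjTranspose, fromBlocks_conjTranspose, uncertaintyBlock_conjTranspose,
      uncertaintyBlock_conjTranspose, conjTranspose_zero, conjTranspose_zero]
    rfl

theorem fromBlocks_mem_commutant_coupledStructure_iff
    {Q₁₁ : Matrix (StateIdx n m) (StateIdx n m) 𝕜} {Q₁₂ : Matrix (StateIdx n m) (StateIdx nK m) 𝕜}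
    {Q₂₁ : Matrix (StateIdx nK m) (StateIdx n m) 𝕜}
    {Q₂₂ : Matrix (StateIdx nK m) (StateIdx nK m) 𝕜} :
    fromBlocks Q₁₁ Q₁₂ Q₂₁ Q₂₂ ∈ commutant 𝕜 (coupledStructure n nK m) ↔
      ∀ δ : (k : Fin d) → Matrix (Fin (m k)) (Fin (m k)) ℂ,
        Q₁₁.map (RCLike.map 𝕜 ℂ) * uncertaintyBlock n m δ =
          uncertaintyBlock n m δ * Q₁₁.map (RCLike.map 𝕜 ℂ) ∧
        Q₁₂.map (RCLike.map 𝕜 ℂ) * uncertaintyBlock nK m δ =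
          uncertaintyBlock n m δ * Q₁₂.map (RCLike.map 𝕜 ℂ) ∧
        Q₂₁.map (RCLike.map 𝕜 ℂ) * uncertaintyBlock n m δ =
          uncertaintyBlock nK m δ * Q₂₁.map (RCLike.map 𝕜 ℂ) ∧
        Q₂₂.map (RCLike.map 𝕜 ℂ) * uncertaintyBlock nK m δ =
          uncertaintyBlock nK m δ * Q₂₂.map (RCLike.map 𝕜 ℂ) := by
  simp only [commutant, coupledStructure, Set.mem_ofPred_eq, Set.forall_mem_range, fromBlocks_map,
    fromBlocks_multiply, Matrix.mul_zero, Matrix.zero_mul, add_zero, zero_add, fromBlocks_inj]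

theorem toBlocks₁₁_mem_commutant_uncertaintyStructure
    {Q : Matrix (StateIdx n m ⊕ StateIdx nK m) (StateIdx n m ⊕ StateIdx nK m) 𝕜}
    (hQ : Q ∈ commutant 𝕜 (coupledStructure n nK m)) :
    Q.toBlocks₁₁ ∈ commutant 𝕜 (uncertaintyStructure n m) := by
  rintro _ ⟨δ, rfl⟩
  rw [← fromBlocks_toBlocks Q, fromBlocks_mem_commutant_coupledStructure_iff] at hQ
  exact (hQ δ).1

end UncertaintyStructure

section QStability

open Matrix
open scoped Topology

variable {𝕜 : Type*} [RCLike 𝕜] {ι κ μ : Type*} [Fintype ι] [Fintype κ] [Fintype μ]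
  {S : Set (Matrix ι ι ℂ)}

theorem exists_posDefOn_stein_ker_iff (A : Matrix ι ι 𝕜) (B : Matrix ι κ 𝕜) :
    (∃ Y ∈ commutant 𝕜 S, Y.PosDef ∧ PosDefOn (stein A Y) (LinearMap.ker Bᴴ.mulVecLin)) ↔
      ∃ Y ∈ commutant 𝕜 S, Y.PosDef ∧ (-(A * Y * Aᴴ - Y - B * Bᴴ)).PosDef := by
  have hneg (Y : Matrix ι ι 𝕜) : -(A * Y * Aᴴ - Y - B * Bᴴ) = stein A Y + B * Bᴴ := by
    rw [stein]
    abel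
  simp only [hneg]
  constructor
  · rintro ⟨Y, hYS, hY, hB⟩
    obtain ⟨t, ht, h⟩ :=
      (posDefOn_ker_iff_exists_posDef_add (isHermitian_stein hY.1 A) B).1 hB
    refine ⟨(t * t)⁻¹ • Y, smul_mem_commutant _ hYS, hY.smul (by positivity), ?_⟩
    have hscale : stein A ((t * t)⁻¹ • Y) + B * Bᴴ =
        (t * t)⁻¹ • (stein A Y + (t • B) * (t • B)ᴴ) := by
      rw [smul_add, ← stein_smul, conjTranspose_smul, star_trivial, Matrix.smul_mul t B,
        Matrix.mul_smul, smul_smul t t, inv_smul_smul₀ (mul_self_pos.2 ht.ne').ne']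
    exact hscale ▸ h.smul (by positivity)
  · rintro ⟨Y, hYS, hY, h⟩
    refine ⟨Y, hYS, hY, (posDefOn_ker_iff_exists_posDef_add (isHermitian_stein hY.1 A) B).2
      ⟨1, one_pos, ?_⟩⟩
    rwa [one_smul]

variable [DecidableEq ι]

theorem norm_inv_mul_mul_lt_one_iff {Q : Matrix ι ι 𝕜} (hQ : IsUnit Q) (A : Matrix ι ι 𝕜) :
    ‖toEuclideanCLM (𝕜 := 𝕜) (n := ι) (Q⁻¹ * A * Q)‖ < 1 ↔ (stein A (Q * Qᴴ)).PosDef := by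
  have hQQ : Q * Q⁻¹ = 1 := mul_nonsing_inv _ ((isUnit_iff_isUnit_det _).1 hQ)
  have hconj : stein A (Q * Qᴴ) = Q * (1 - (Q⁻¹ * A * Q) * (Q⁻¹ * A * Q)ᴴ) * Qᴴ := calc
    _ = Q * Qᴴ - (Q * Q⁻¹) * A * Q * Qᴴ * Aᴴ * (Q * Q⁻¹)ᴴ := by simp [stein, hQQ, Matrix.mul_assoc]
    _ = _ := by
      simp only [conjTranspose_mul, Matrix.mul_sub, Matrix.sub_mul, Matrix.mul_one,
        Matrix.mul_assoc]
  rw [norm_toEuclideanCLM_lt_one_iff_posDef_one_sub_mul_conjTranspose, hconj]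
  exact (IsUnit.posDef_star_right_conjugate_iff hQ).symm

theorem isQStable_iff_exists_posDef_stein (hS : star S = S) {A : Matrix ι ι 𝕜} :
    IsQStable A S ↔ ∃ W ∈ commutant 𝕜 S, W.PosDef ∧ (stein A W).PosDef := by
  constructor
  · rintro ⟨Q, hQS, hQ, hA⟩
    refine ⟨Q * Qᴴ, ?_, ?_, (norm_inv_mul_mul_lt_one_iff hQ A).1 hA⟩
    · rw [← mem_commutantStarSubalgebra hS] at hQS ⊢
      exact mul_mem hQS (star_mem hQS)
    · exact PosDef.mul_conjTranspose_self _ (vecMul_injective_of_isUnit hQ)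
  · rintro ⟨W, hWS, hW, hA⟩
    obtain ⟨Q, hQS, hQ, rfl⟩ := exists_mul_conjTranspose_eq_of_mem_commutant hS hWS hW
    exact ⟨Q, hQS, hQ, (norm_inv_mul_mul_lt_one_iff hQ A).2 hA⟩

theorem isOpen_setOf_isQStable (S : Set (Matrix ι ι ℂ)) :
    IsOpen {A : Matrix ι ι 𝕜 | IsQStable A S} := by
  have hcont (Q : Matrix ι ι 𝕜) :
      Continuous fun A => toEuclideanCLM (𝕜 := 𝕜) (n := ι) (Q⁻¹ * A * Q) :=
    (toEuclideanCLM (𝕜 := 𝕜) (n := ι)).toAlgEquiv.toLinearMap.continuous_of_finiteDimensional.comp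
      (by fun_prop)
  have hunion : {A : Matrix ι ι 𝕜 | IsQStable A S} = ⋃ Q ∈ {Q ∈ commutant 𝕜 S | IsUnit Q},
      {A | ‖toEuclideanCLM (𝕜 := 𝕜) (n := ι) (Q⁻¹ * A * Q)‖ < 1} := by
    ext A
    simp [IsQStable, and_assoc]
  rw [hunion]
  exact isOpen_biUnion fun Q _ => isOpen_lt (hcont Q).norm continuous_const

theorem posDef_stein_conjTranspose_inv {A W : Matrix ι ι 𝕜} (hW : W.PosDef)
    (h : (stein A W).PosDef) : (stein Aᴴ W⁻¹).PosDef := by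
  rw [stein, conjTranspose_conjTranspose]
  exact posDef_inv_sub_conjTranspose_mul_inv_mul hW h

theorem exists_isQStable_add_mul_mul_iff (hS : star S = S) (A : Matrix ι ι 𝕜)
    (B : Matrix ι κ 𝕜) (C : Matrix μ ι 𝕜) :
    (∃ K : Matrix κ μ 𝕜, IsQStable (A + B * K * C) S) ↔
      ∃ X ∈ commutant 𝕜 S, X.PosDef ∧ PosDefOn (stein A X⁻¹) (LinearMap.ker Bᴴ.mulVecLin) ∧
        PosDefOn (stein Aᴴ X) (LinearMap.ker C.mulVecLin) := by
  constructor
  · rintro ⟨K, hK⟩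
    obtain ⟨W, hWS, hW, hA⟩ := (isQStable_iff_exists_posDef_stein hS).1 hK
    refine ⟨W⁻¹, inv_mem_commutant hWS hW.isUnit, hW.inv, ?_, ?_⟩
    · rw [nonsing_inv_nonsing_inv _ ((isUnit_iff_isUnit_det _).1 hW.isUnit),
        ← posDefOn_stein_add_mul_iff A W B (K * C), ← Matrix.mul_assoc]
      exact posDefOn_of_posDef hA _
    · have hA' := posDef_stein_conjTranspose_inv hW hA
      rw [conjTranspose_add, conjTranspose_mul] at hA'
      have := posDefOn_of_posDef hA' (LinearMap.ker Cᴴᴴ.mulVecLin)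
      rwa [posDefOn_stein_add_mul_iff, conjTranspose_conjTranspose] at this
  · rintro ⟨X, hXS, hX, hB, hC⟩
    rw [← conjTranspose_conjTranspose C] at hC
    obtain ⟨s, -, hs⟩ :=
      (posDefOn_ker_iff_exists_posDef_add (isHermitian_stein hX.1.inv A) B).1 hB
    obtain ⟨t, -, ht⟩ :=
      (posDefOn_ker_iff_exists_posDef_add (isHermitian_stein hX.1 Aᴴ) Cᴴ).1 hC
    have hXX := nonsing_inv_nonsing_inv X ((isUnit_iff_isUnit_det _).1 hX.isUnit)
    obtain ⟨K, hK⟩ := exists_outputFeedback_posDef hX.inv A (s • B) (t • C) hs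
      (by simpa [hXX] using ht)
    have hgain : A + (s • B) * K * (t • C) = A + B * ((s * t) • K) * C := by
      simp [smul_smul, mul_comm]
    rw [hgain, hXX] at hK
    refine ⟨(s * t) • K, (isQStable_iff_exists_posDef_stein hS).2
      ⟨X⁻¹, inv_mem_commutant hXS hX.isUnit, hX.inv, ?_⟩⟩
    simpa using posDef_stein_conjTranspose_inv hX hK

theorem exists_mem_isUnit_one_add_smul {U : Set 𝕜} (hU : U ∈ 𝓝 1) (N : Matrix ι ι 𝕜) :
    ∃ z ∈ U, IsUnit (1 + z • N) := by
  have hinf : (U \ {0}).Infinite := (infinite_of_mem_nhds 1 hU).sdiff (Set.finite_singleton 0)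
  have hfin : ((fun z : 𝕜 => -z⁻¹) ⁻¹' spectrum 𝕜 N).Finite :=
    N.finite_spectrum.preimage fun _ _ _ _ h => inv_injective (neg_injective h)
  obtain ⟨z, ⟨hzU, hz : z ≠ 0⟩, hzN⟩ := (hinf.sdiff hfin).nonempty
  refine ⟨z, hzU, ?_⟩
  have hunit : IsUnit (algebraMap 𝕜 (Matrix ι ι 𝕜) (-z⁻¹) - N) := spectrum.notMem_iff.1 hzN
  have hfactor : 1 + z • N = (-z) • (algebraMap 𝕜 (Matrix ι ι 𝕜) (-z⁻¹) - N) := by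
    rw [Algebra.algebraMap_eq_smul_one, smul_sub, smul_smul, neg_mul_neg, mul_inv_cancel₀ hz,
      one_smul, neg_smul, sub_neg_eq_add]
  rw [hfactor]
  exact hunit.smul (Units.mk0 (-z) (neg_ne_zero.2 hz))

/-- The gain `(I - K D)⁻¹ K` absorbs the feedthrough `D`; conversely an arbitrary gain has this form
after a small perturbation, which open conditions survive. -/
theorem exists_isQStable_lowerLFT_iff [DecidableEq κ] (A : Matrix ι ι 𝕜) (B : Matrix ι κ 𝕜)
    (C : Matrix μ ι 𝕜) (D : Matrix μ κ 𝕜) :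
    (∃ K : Matrix κ μ 𝕜, IsUnit (1 - K * D) ∧ IsQStable (lowerLFT A B C D K) S) ↔
      ∃ K : Matrix κ μ 𝕜, IsQStable (A + B * K * C) S := by
  constructor
  · rintro ⟨K, -, hK⟩
    exact ⟨(1 - K * D)⁻¹ * K, by rwa [← Matrix.mul_assoc]⟩
  · rintro ⟨K, hK⟩
    have hnhds : ∀ᶠ z : 𝕜 in 𝓝 1, IsQStable (A + B * (z • K) * C) S := by
      have hcont : Continuous fun z : 𝕜 => A + B * (z • K) * C := by fun_prop
      refine hcont.continuousAt.eventually_mem ((isOpen_setOf_isQStable S).mem_nhds ?_)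
      simpa using hK
    obtain ⟨z, hz, hunit⟩ := exists_mem_isUnit_one_add_smul hnhds (K * D)
    set L := z • K
    rw [← Matrix.smul_mul] at hunit
    have hdet := (isUnit_iff_isUnit_det _).1 hunit
    have hinv : 1 - (1 + L * D)⁻¹ * L * D = (1 + L * D)⁻¹ := by
      rw [Matrix.mul_assoc, sub_eq_iff_eq_add, ← mul_one_add, nonsing_inv_mul _ hdet]
    refine ⟨(1 + L * D)⁻¹ * L, ?_, ?_⟩
    · rw [hinv]
      exact isUnit_nonsing_inv_iff.2 hunit
    · rwa [lowerLFT, hinv, nonsing_inv_nonsing_inv _ hdet, Matrix.mul_assoc B,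
        ← Matrix.mul_assoc _ _ L, mul_nonsing_inv _ hdet, Matrix.one_mul]

end QStability

section Augmentation

open Matrix

variable {𝕜 : Type*} [RCLike 𝕜] {ι κ μ : Type*} [Fintype ι] [Fintype κ]

theorem posDefOn_ker_fromBlocks_zero_one_iff [DecidableEq κ] (M : Matrix (ι ⊕ κ) (ι ⊕ κ) 𝕜)
    (N : Matrix μ ι 𝕜) :
    PosDefOn M (LinearMap.ker (fromBlocks 0 1 N 0 : Matrix (κ ⊕ μ) (ι ⊕ κ) 𝕜).mulVecLin) ↔
      PosDefOn M.toBlocks₁₁ (LinearMap.ker N.mulVecLin) := by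
  have hker (v : ι → 𝕜) (w : κ → 𝕜) :
      (fromBlocks 0 1 N 0 : Matrix (κ ⊕ μ) (ι ⊕ κ) 𝕜) *ᵥ Sum.elim v w = 0 ↔ w = 0 ∧ N *ᵥ v = 0 := by
    rw [fromBlocks_mulVec, ← Sum.elim_zero_zero, Sum.elim_eq_iff]
    simp
  have hform (v : ι → 𝕜) : star (Sum.elim v 0 : ι ⊕ κ → 𝕜) ⬝ᵥ M *ᵥ Sum.elim v 0 =
      star v ⬝ᵥ M.toBlocks₁₁ *ᵥ v := by
    conv_lhs => rw [← fromBlocks_toBlocks M]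
    rw [fromBlocks_mulVec, Function.star_sumElim, sumElim_dotProduct_sumElim]
    simp
  constructor
  · intro h v hv hv0
    rw [← hform]
    refine h _ ((hker v 0).2 ⟨rfl, hv⟩) fun h0 => hv0 ?_
    simpa using congrArg (· ∘ Sum.inl) h0
  · intro h x hx hx0
    rw [LinearMap.mem_ker, mulVecLin_apply, ← Sum.elim_comp_inl_inr x, hker] at hx
    rw [← Sum.elim_comp_inl_inr x, hx.1] at hx0 ⊢
    rw [hform]
    exact h _ hx.2 (fun h0 => hx0 (by simp [h0]))

theorem toBlocks₁₁_stein_fromBlocks (A : Matrix ι ι 𝕜) (W : Matrix (ι ⊕ κ) (ι ⊕ κ) 𝕜) :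
    (stein (fromBlocks A 0 0 0) W).toBlocks₁₁ = stein A W.toBlocks₁₁ := by
  conv_lhs => rw [← fromBlocks_toBlocks W]
  simp [stein, fromBlocks_conjTranspose, fromBlocks_multiply, sub_eq_add_neg, fromBlocks_neg,
    fromBlocks_add]

theorem exists_posDef_smul_sub {M N : Matrix ι ι 𝕜} (hM : M.PosDef) (hN : N.IsHermitian) :
    ∃ t : ℝ, 0 < t ∧ (t • M - N).PosDef := by
  classical
  simp only [sub_eq_neg_add]
  refine exists_posDef_add_smul hN.neg hM.posSemidef fun x hx hx0 => ?_
  exact absurd (mulVec_injective_of_isUnit hM.isUnit (hx.trans (mulVec_zero M).symm)) hx0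

variable [DecidableEq κ]

theorem posDef_fromBlocks_of_posDef_sub {A : Matrix ι ι 𝕜} {B : Matrix ι κ 𝕜} {D : Matrix κ κ 𝕜}
    (hD : D.PosDef) (h : (A - B * D⁻¹ * Bᴴ).PosDef) : (fromBlocks A B Bᴴ D).PosDef := by
  classical
  have : Invertible D := hD.isUnit.invertible
  refine ((hD.fromBlocks₂₂ A B).2 h.posSemidef).posDef_iff_isUnit.2 ?_
  rw [isUnit_fromBlocks_iff_of_invertible₂₂, invOf_eq_nonsing_inv]
  exact h.isUnit

variable [DecidableEq ι]

theorem toBlocks₁₁_inv_of_isEmpty [IsEmpty κ] {W : Matrix (ι ⊕ κ) (ι ⊕ κ) 𝕜} (hW : W.PosDef) :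
    W⁻¹.toBlocks₁₁ = W.toBlocks₁₁⁻¹ := by
  refine (inv_eq_right_inv ?_).symm
  calc W.toBlocks₁₁ * W⁻¹.toBlocks₁₁ = (W * W⁻¹).toBlocks₁₁ := by
        ext i j
        simp [toBlocks₁₁, Matrix.mul_apply]
    _ = 1 := by rw [mul_inv_cancel_of_posDef hW, ← fromBlocks_one, toBlocks_fromBlocks₁₁]

theorem posDef_fromBlocks_sub_inv {X Y : Matrix ι ι 𝕜} (hY : Y.PosDef) (hE : (X - Y⁻¹).PosDef) :
    (fromBlocks X (X - Y⁻¹) (X - Y⁻¹) (X - Y⁻¹)).PosDef := by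
  have hschur : (X - (X - Y⁻¹) * (X - Y⁻¹)⁻¹ * (X - Y⁻¹)ᴴ).PosDef := by
    rw [mul_inv_cancel_of_posDef hE, Matrix.one_mul, hE.1.eq, sub_sub_cancel]
    exact hY.inv
  have := posDef_fromBlocks_of_posDef_sub hE hschur
  rwa [hE.1.eq] at this

theorem toBlocks₁₁_inv_fromBlocks_sub_inv {X Y : Matrix ι ι 𝕜} (hY : Y.PosDef)
    (hE : (X - Y⁻¹).PosDef) :
    (fromBlocks X (X - Y⁻¹) (X - Y⁻¹) (X - Y⁻¹))⁻¹.toBlocks₁₁ = Y := by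
  set E := X - Y⁻¹
  have hX : X = E + Y⁻¹ := (sub_add_cancel X Y⁻¹).symm
  have hinv : fromBlocks X E E E * fromBlocks Y (-Y) (-Y) (Y + E⁻¹) = 1 := by
    rw [fromBlocks_multiply, ← fromBlocks_one]
    congr 1 <;> simp [hX, Matrix.add_mul, Matrix.mul_add, inv_mul_cancel_of_posDef hY,
      mul_inv_cancel_of_posDef hE]
  rw [inv_eq_right_inv hinv, toBlocks_fromBlocks₁₁]

end Augmentation

namespace LFTPlant

open Matrix

variable {𝕜 : Type*} [RCLike 𝕜] {d : ℕ} {n nK m : Fin d → ℕ} {u₁ u₂ y₁ y₂ : ℕ}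

variable (nK) in
/-- The state matrix of the plant augmented by the controller state space, on which the controller
acts as a static gain from `(x_K, y)` to `(x_K, u)`. -/
def augmentedA (P : LFTPlant 𝕜 n m u₁ u₂ y₁ y₂) :
    Matrix (StateIdx n m ⊕ StateIdx nK m) (StateIdx n m ⊕ StateIdx nK m) 𝕜 :=
  fromBlocks P.A 0 0 0

variable (nK) in
/-- The input matrix of the augmented plant. -/
def augmentedB (P : LFTPlant 𝕜 n m u₁ u₂ y₁ y₂) :
    Matrix (StateIdx n m ⊕ StateIdx nK m) (StateIdx nK m ⊕ Fin u₂) 𝕜 :=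
  fromBlocks 0 P.B₂ 1 0

variable (nK) in
/-- The output matrix of the augmented plant. -/
def augmentedC (P : LFTPlant 𝕜 n m u₁ u₂ y₁ y₂) :
    Matrix (StateIdx nK m ⊕ Fin y₂) (StateIdx n m ⊕ StateIdx nK m) 𝕜 :=
  fromBlocks 0 1 P.C₂ 0

variable (nK) in
/-- The feedthrough matrix of the augmented plant. -/
def augmentedD (P : LFTPlant 𝕜 n m u₁ u₂ y₁ y₂) :
    Matrix (StateIdx nK m ⊕ Fin y₂) (StateIdx nK m ⊕ Fin u₂) 𝕜 :=
  fromBlocks 0 0 0 P.D₂₂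

theorem closedLoopA_eq_lowerLFT (P : LFTPlant 𝕜 n m u₁ u₂ y₁ y₂)
    (K : LFTController 𝕜 nK m u₂ y₂) :
    P.closedLoopA K = lowerLFT (P.augmentedA nK) (P.augmentedB nK) (P.augmentedC nK)
      (P.augmentedD nK) (fromBlocks K.A K.B K.C K.D) := by
  simp only [closedLoopA, closedLoop, lowerLFT, fromRows_mul]
  ext
  simp [toBlocks₁₁, augmentedA, augmentedB, augmentedC, augmentedD]

theorem wellPosed_iff (P : LFTPlant 𝕜 n m u₁ u₂ y₁ y₂) (K : LFTController 𝕜 nK m u₂ y₂) :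
    P.WellPosed K ↔ IsUnit (1 - fromBlocks K.A K.B K.C K.D * P.augmentedD nK) := by
  have hblocks : 1 - fromBlocks K.A K.B K.C K.D * P.augmentedD nK =
      fromBlocks 1 (-(K.B * P.D₂₂)) 0 (1 - K.D * P.D₂₂) := by
    rw [augmentedD, ← fromBlocks_one, fromBlocks_multiply, sub_eq_add_neg, fromBlocks_neg,
      fromBlocks_add]
    simp [sub_eq_add_neg]
  rw [hblocks, isUnit_fromBlocks_zero₂₁, and_iff_right isUnit_one, WellPosed,
    isUnit_iff_isUnit_det, isUnit_iff_isUnit_det, det_one_sub_mul_comm]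

theorem exists_isQStabilizedBy_iff_exists_isQStable (P : LFTPlant 𝕜 n m u₁ u₂ y₁ y₂) :
    (∃ K : LFTController 𝕜 nK m u₂ y₂, P.IsQStabilizedBy K) ↔
      ∃ K : Matrix (StateIdx nK m ⊕ Fin u₂) (StateIdx nK m ⊕ Fin y₂) 𝕜,
        IsQStable (P.augmentedA nK + P.augmentedB nK * K * P.augmentedC nK)
          (coupledStructure n nK m) := by
  rw [← exists_isQStable_lowerLFT_iff _ _ _ (P.augmentedD nK)]
  simp only [IsQStabilizedBy, wellPosed_iff, closedLoopA_eq_lowerLFT]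
  constructor
  · rintro ⟨K, hK⟩
    exact ⟨_, hK⟩
  · rintro ⟨K, hK⟩
    rw [← fromBlocks_toBlocks K] at hK
    exact ⟨⟨K.toBlocks₁₁, K.toBlocks₁₂, K.toBlocks₂₁, K.toBlocks₂₂⟩, hK⟩

theorem exists_isQStabilizedBy_iff_exists_posDef (P : LFTPlant 𝕜 n m u₁ u₂ y₁ y₂) :
    (∃ K : LFTController 𝕜 nK m u₂ y₂, P.IsQStabilizedBy K) ↔
      ∃ W ∈ commutant 𝕜 (coupledStructure n nK m), W.PosDef ∧
        PosDefOn (stein P.A W⁻¹.toBlocks₁₁) (LinearMap.ker P.B₂ᴴ.mulVecLin) ∧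
        PosDefOn (stein P.Aᴴ W.toBlocks₁₁) (LinearMap.ker P.C₂.mulVecLin) := by
  rw [exists_isQStabilizedBy_iff_exists_isQStable,
    exists_isQStable_add_mul_mul_iff star_coupledStructure]
  simp only [augmentedA, augmentedB, augmentedC, fromBlocks_conjTranspose, conjTranspose_zero,
    conjTranspose_one, posDefOn_ker_fromBlocks_zero_one_iff, toBlocks₁₁_stein_fromBlocks]

theorem isEmpty_stateIdx_zero (m : Fin d → ℕ) : IsEmpty (StateIdx (fun _ => 0) m) :=
  ⟨fun x => x.2.2.elim0⟩

theorem exists_static_isQStabilizedBy_iff (P : LFTPlant 𝕜 n m u₁ u₂ y₁ y₂) :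
    (∃ K : LFTController 𝕜 (fun _ : Fin d => 0) m u₂ y₂, P.IsQStabilizedBy K) ↔
      ∃ X ∈ commutant 𝕜 (uncertaintyStructure n m), X.PosDef ∧
        PosDefOn (stein P.A X⁻¹) (LinearMap.ker P.B₂ᴴ.mulVecLin) ∧
        PosDefOn (stein P.Aᴴ X) (LinearMap.ker P.C₂.mulVecLin) := by
  have := isEmpty_stateIdx_zero m
  rw [exists_isQStabilizedBy_iff_exists_posDef]
  constructor
  · rintro ⟨W, hWS, hW, hB, hC⟩
    rw [toBlocks₁₁_inv_of_isEmpty hW] at hB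
    exact ⟨W.toBlocks₁₁, toBlocks₁₁_mem_commutant_uncertaintyStructure hWS,
      hW.submatrix Sum.inl_injective, hB, hC⟩
  · rintro ⟨X, hXS, hX, hB, hC⟩
    have hW : (fromBlocks X 0 0ᴴ 1 :
        Matrix (StateIdx n m ⊕ StateIdx (fun _ => 0) m) _ 𝕜).PosDef :=
      posDef_fromBlocks_of_posDef_sub .one (by simpa using hX)
    refine ⟨_, fromBlocks_mem_commutant_coupledStructure_iff.2 fun δ => ⟨hXS _ ⟨δ, rfl⟩, ?_⟩,
      hW, ?_, by rwa [toBlocks_fromBlocks₁₁]⟩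
    · exact ⟨Subsingleton.elim _ _, Subsingleton.elim _ _, Subsingleton.elim _ _⟩
    · rwa [toBlocks₁₁_inv_of_isEmpty hW, toBlocks_fromBlocks₁₁]

theorem exists_dynamic_isQStabilizedBy_iff (P : LFTPlant 𝕜 n m u₁ u₂ y₁ y₂) :
    (∃ (nK : Fin d → ℕ) (K : LFTController 𝕜 nK m u₂ y₂), P.IsQStabilizedBy K) ↔
      (∃ X ∈ commutant 𝕜 (uncertaintyStructure n m), X.PosDef ∧
        PosDefOn (stein P.Aᴴ X) (LinearMap.ker P.C₂.mulVecLin)) ∧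
      ∃ Y ∈ commutant 𝕜 (uncertaintyStructure n m), Y.PosDef ∧
        PosDefOn (stein P.A Y) (LinearMap.ker P.B₂ᴴ.mulVecLin) := by
  simp only [exists_isQStabilizedBy_iff_exists_posDef]
  constructor
  · rintro ⟨nK, W, hWS, hW, hB, hC⟩
    have hWS' := inv_mem_commutant hWS hW.isUnit
    exact ⟨⟨W.toBlocks₁₁, toBlocks₁₁_mem_commutant_uncertaintyStructure hWS,
      hW.submatrix Sum.inl_injective, hC⟩, W⁻¹.toBlocks₁₁,
      toBlocks₁₁_mem_commutant_uncertaintyStructure hWS', hW.inv.submatrix Sum.inl_injective, hB⟩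
  · rintro ⟨⟨X, hXS, hX, hC⟩, Y, hYS, hY, hB⟩
    obtain ⟨t, ht, hE⟩ := exists_posDef_smul_sub hX hY.inv.1
    have htXS : t • X ∈ commutant 𝕜 (uncertaintyStructure n m) := smul_mem_commutant t hXS
    have hES := sub_mem_commutant htXS (inv_mem_commutant hYS hY.isUnit)
    refine ⟨n, _, fromBlocks_mem_commutant_coupledStructure_iff.2 fun δ => ?_,
      posDef_fromBlocks_sub_inv hY hE, ?_, ?_⟩
    · exact ⟨htXS _ ⟨δ, rfl⟩, hES _ ⟨δ, rfl⟩, hES _ ⟨δ, rfl⟩, hES _ ⟨δ, rfl⟩⟩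
    · rwa [toBlocks₁₁_inv_fromBlocks_sub_inv hY hE]
    · rw [toBlocks_fromBlocks₁₁]
      exact hC.stein_smul ht

end LFTPlant

theorem theorem3p2 {𝕜 : Type*} [RCLike 𝕜] {d : ℕ} (n m : Fin d → ℕ) {u₁ u₂ y₁ y₂ : ℕ}
    (P : LFTPlant 𝕜 n m u₁ u₂ y₁ y₂) :
    -- (1) static output feedback: all controller multiplicities are zero
    (∀ (p q : ℕ) (Bperp : Matrix (StateIdx n m) (Fin p) 𝕜) (Cperp : Matrix (Fin q) (StateIdx n m) 𝕜),
      Function.Injective Bperp.mulVecLin →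
      LinearMap.range Bperp.mulVecLin = LinearMap.ker P.B₂ᴴ.mulVecLin →
      Function.Injective Cperpᴴ.mulVecLin →
      LinearMap.range Cperpᴴ.mulVecLin = LinearMap.ker P.C₂.mulVecLin →
      ((∃ K : LFTController 𝕜 (fun _ : Fin d => 0) m u₂ y₂, P.IsQStabilizedBy K) ↔
        ∃ X ∈ commutant 𝕜 (uncertaintyStructure n m), X.PosDef ∧
          (-(Bperpᴴ * P.A * X⁻¹ * P.Aᴴ * Bperp - Bperpᴴ * X⁻¹ * Bperp)).PosDef ∧
          (-(Cperp * P.Aᴴ * X * P.A * Cperpᴴ - Cperp * X * Cperpᴴ)).PosDef)) ∧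
    -- (2) dynamic output feedback with arbitrary controller multiplicities
    ((∃ (nK : Fin d → ℕ) (K : LFTController 𝕜 nK m u₂ y₂), P.IsQStabilizedBy K) ↔
      ∃ X ∈ commutant 𝕜 (uncertaintyStructure n m),
      ∃ Y ∈ commutant 𝕜 (uncertaintyStructure n m), X.PosDef ∧ Y.PosDef ∧
        (-(P.A * Y * P.Aᴴ - Y - P.B₂ * P.B₂ᴴ)).PosDef ∧
        (-(P.Aᴴ * X * P.A - X - P.C₂ᴴ * P.C₂)).PosDef) := by
  constructor
  · intro p q Bperp Cperp hBinj hBrange hCinj hCrange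
    rw [P.exists_static_isQStabilizedBy_iff, ← hBrange, ← hCrange]
    refine exists_congr fun X => and_congr_right fun _ => and_congr_right fun hX => and_congr ?_ ?_
    · rw [← posDef_conjTranspose_mul_mul_iff_posDefOn_range (isHermitian_stein hX.1.inv _) hBinj]
      simp only [stein, neg_sub, Matrix.mul_sub, Matrix.sub_mul, Matrix.mul_assoc]
    · rw [← posDef_conjTranspose_mul_mul_iff_posDefOn_range (isHermitian_stein hX.1 _) hCinj]
      simp only [stein, neg_sub, Matrix.mul_sub, Matrix.sub_mul, Matrix.mul_assoc,
        Matrix.conjTranspose_conjTranspose]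
  · have hdual := exists_posDefOn_stein_ker_iff (S := uncertaintyStructure n m) P.Aᴴ P.C₂ᴴ
    rw [Matrix.conjTranspose_conjTranspose, Matrix.conjTranspose_conjTranspose] at hdual
    rw [P.exists_dynamic_isQStabilizedBy_iff, hdual, exists_posDefOn_stein_ker_iff]
    constructor
    · rintro ⟨⟨X, hXS, hX, hC⟩, Y, hYS, hY, hB⟩
      exact ⟨X, hXS, Y, hYS, hX, hY, hB, hC⟩
    · rintro ⟨X, hXS, Y, hYS, hX, hY, hB, hC⟩
      exact ⟨⟨X, hXS, hX, hC⟩, Y, hYS, hY, hB⟩
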